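/- Let $A\in\mathbb R^{n\times n}$, $B\in\mathbb R^{n\times m}$, let $Q\in\mathbb R^{n\times n}$ be symmetric positive semidefinite and $R\in\mathbb R^{m\times m}$ symmetric positive definite, with $(A,B)$ stabilizable and $(A,\sqrt Q)$ detectable. Prime denotes transposition, $\|\cdot\|$ the induced $2$-norm, and a stability matrix is a square matrix all of whose eigenvalues are less than one in absolute value. For $K\in\mathbb R^{n\times n}$ and $L\in\mathbb R^{m\times n}$ put $$F(K)=A'\big(K-KB(B'KB+R)^{-1}B'K\big)A+Q,\qquad F_L(K)=(A+BL)'K(A+BL)+Q+L'RL,$$ let $F^k$ be the $k$-fold composition of $F$, and let $\mathcal D$ be the set of symmetric $K\ge 0$ with $F(K)\le K$ (in the order of symmetric matrices). Then: 1. There is exactly one positive semidefinite $K^*$ with $K^*=F(K^*)$. Put $L^*=-(B'K^*B+R)^{-1}B'K^*A$, and $\beta_\ell=\min\{\|(A+BL^*)^{\ell-1}\|^2,1\}$ for integers $\ell\ge 1$. 2. $\sum_{i\ge 0}\|D^i\|^2<\infty$ for every $n\times n$ stability matrix $D$. If $A+BL$ is a stability matrix, then the equation $K_L=F_L(K_L)$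 has exactly one solution $K_L$, this solution is positive semidefinite, and $$K_L-K^*=(A+BL)'(K_L-K^*)(A+BL)+(L-L^*)'(B'K^*B+R)(L-L^*).$$ 3. Let $\overline K\in\mathcal D$, let $\tilde L$ satisfy $F_{\tilde L}(\overline K)=F(\overline K)$, and let $K_{\tilde L}=F_{\tilde L}(K_{\tilde L})$. Then $\|K_{\tilde L}-K^*\|\le\gamma\,\|\overline K-K^*\|^2$ for some $\gamma>0$. The estimate also holds with $\gamma$ replaced by the explicit constant $$\gamma_0(\overline K)=\eta^2\,\|B'K^*B+R\|\sum_{i=0}^\infty\|(A+B\tilde L)^i\|^2,$$ $$\eta=\|(B'K^*B+R)^{-1}\|\big(\|B'\|\|A\|+\|B'\|\|B\|\|(B'\overline KB+R)^{-1}\|\|B'\overline KA\|\big).$$ 4. Let $K\in\mathcal D$ and let $\ell\ge 1$ be an integer. There is exactly one matrix $\tilde L$ (the MPC gain) with $F_{\tilde L}(F^{\ell-1}(K))=F^\ell(K)$, and $A+B\tilde L$ is a stability matrix. With $K_{\tilde L}=F_{\tilde L}(K_{\tilde L})$, there is $\gamma>0$ such that $$\|K_{\tilde L}-K^*\|\le\gamma\,\|F^{\ell-1}(K)-K^*\|^2\qquad\text{and}\qquad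 \|K_{\tilde L}-K^*\|\le\gamma\,\beta_\ell^2\,\|K-K^*\|^2,$$ and the second bound also holds with $\gamma$ replaced by $\gamma_0(F^{\ell-1}(K))$. -/

import Mathlib

open scoped Matrix Matrix.Norms.L2Operator MatrixOrder

namespace LQR

variable {n m p : ℕ}

/-- A real square matrix is a stability matrix if all of its (complex) eigenvalues are less than one
in absolute value. -/
def IsStabilityMatrix (M : Matrix (Fin n) (Fin n) ℝ) : Prop :=
  ∀ z ∈ spectrum ℂ (M.map (algebraMap ℝ ℂ)), ‖z‖ < 1

/-- `(A, B)` is stabilizable: some state feedback makes the closed loop stable. -/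
def Stabilizable (A : Matrix (Fin n) (Fin n) ℝ) (B : Matrix (Fin n) (Fin m) ℝ) : Prop :=
  ∃ L : Matrix (Fin m) (Fin n) ℝ, IsStabilityMatrix (A + B * L)

/-- `(A, C)` is detectable: some output injection makes the error dynamics stable. -/
def Detectable (A : Matrix (Fin n) (Fin n) ℝ) (C : Matrix (Fin p) (Fin n) ℝ) : Prop :=
  ∃ G : Matrix (Fin n) (Fin p) ℝ, IsStabilityMatrix (A + G * C)

/-- The Bellman operator `F(K) = A'(K - K B (B'KB + R)⁻¹ B'K)A + Q`. -/
noncomputable def bellman (A : Matrix (Fin n) (Fin n) ℝ) (B : Matrix (Fin n) (Fin m) ℝ)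
    (Q : Matrix (Fin n) (Fin n) ℝ) (R : Matrix (Fin m) (Fin m) ℝ)
    (K : Matrix (Fin n) (Fin n) ℝ) : Matrix (Fin n) (Fin n) ℝ :=
  Aᵀ * (K - K * B * (Bᵀ * K * B + R)⁻¹ * Bᵀ * K) * A + Q

/-- The `L`-Bellman operator `F_L(K) = (A + BL)'K(A + BL) + Q + L'RL`. -/
def gainBellman (A : Matrix (Fin n) (Fin n) ℝ) (B : Matrix (Fin n) (Fin m) ℝ)
    (Q : Matrix (Fin n) (Fin n) ℝ) (R : Matrix (Fin m) (Fin m) ℝ)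
    (L : Matrix (Fin m) (Fin n) ℝ) (K : Matrix (Fin n) (Fin n) ℝ) : Matrix (Fin n) (Fin n) ℝ :=
  (A + B * L)ᵀ * K * (A + B * L) + Q + Lᵀ * R * L

/-- `K` is a positive semidefinite solution of the algebraic Riccati equation `K = F(K)`. -/
def IsRiccatiSolution (A : Matrix (Fin n) (Fin n) ℝ) (B : Matrix (Fin n) (Fin m) ℝ)
    (Q : Matrix (Fin n) (Fin n) ℝ) (R : Matrix (Fin m) (Fin m) ℝ)
    (K : Matrix (Fin n) (Fin n) ℝ) : Prop :=
  K.PosSemidef ∧ K = bellman A B Q R K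

/-- The gain `-(B'KB + R)⁻¹ B'KA`; for the Riccati solution `K = K*` this is the optimal
gain `L*`. -/
noncomputable def riccatiGain (A : Matrix (Fin n) (Fin n) ℝ) (B : Matrix (Fin n) (Fin m) ℝ)
    (R : Matrix (Fin m) (Fin m) ℝ) (K : Matrix (Fin n) (Fin n) ℝ) : Matrix (Fin m) (Fin n) ℝ :=
  -((Bᵀ * K * B + R)⁻¹ * Bᵀ * K * A)

/-- The region of decreasing: symmetric `K` with `F(K) ≤ K`. The comparison `X ≤ Y` is one
between positive semidefinite matrices, so that `K ≥ 0` is part of the definition. -/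
def regionOfDecreasing (A : Matrix (Fin n) (Fin n) ℝ) (B : Matrix (Fin n) (Fin m) ℝ)
    (Q : Matrix (Fin n) (Fin n) ℝ) (R : Matrix (Fin m) (Fin m) ℝ) :
    Set (Matrix (Fin n) (Fin n) ℝ) :=
  {K | K.PosSemidef ∧ (K - bellman A B Q R K).PosSemidef}

/-- `β_ℓ = min {‖(A + BL*)^(ℓ-1)‖², 1}`, for the horizon `ℓ ≥ 1`. -/
noncomputable def beta (A : Matrix (Fin n) (Fin n) ℝ) (B : Matrix (Fin n) (Fin m) ℝ)
    (Lstar : Matrix (Fin m) (Fin n) ℝ) (ℓ : ℕ) : ℝ :=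
  min (‖(A + B * Lstar) ^ (ℓ - 1)‖ ^ 2) 1

/-- `η = ‖(B'K*B + R)⁻¹‖ (‖B'‖‖A‖ + ‖B'‖‖B‖‖(B'K̄B + R)⁻¹‖‖B'K̄A‖)`, in induced 2-norms. -/
noncomputable def newtonEta (A : Matrix (Fin n) (Fin n) ℝ) (B : Matrix (Fin n) (Fin m) ℝ)
    (R : Matrix (Fin m) (Fin m) ℝ) (Kstar Kbar : Matrix (Fin n) (Fin n) ℝ) : ℝ :=
  ‖(Bᵀ * Kstar * B + R)⁻¹‖ *
    (‖Bᵀ‖ * ‖A‖ + ‖Bᵀ‖ * ‖B‖ * ‖(Bᵀ * Kbar * B + R)⁻¹‖ * ‖Bᵀ * Kbar * A‖)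

/-- `η² ‖B'K*B + R‖ ∑ᵢ ‖(A + BL)^i‖²`, in induced 2-norms. -/
noncomputable def newtonGamma (A : Matrix (Fin n) (Fin n) ℝ) (B : Matrix (Fin n) (Fin m) ℝ)
    (R : Matrix (Fin m) (Fin m) ℝ) (Kstar Kbar : Matrix (Fin n) (Fin n) ℝ)
    (L : Matrix (Fin m) (Fin n) ℝ) : ℝ :=
  newtonEta A B R Kstar Kbar ^ 2 * ‖Bᵀ * Kstar * B + R‖ * ∑' i : ℕ, ‖(A + B * L) ^ i‖ ^ 2

end LQR

namespace LQR

/-! ### Induced norm and the order of symmetric matrices -/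

variable {n m : ℕ}

/-! Completing the square gives `F_L(K) = F(K) + (L - G)'(B'KB + R)(L - G)`, with `G` the Riccati
gain of `K`. So `F` is the minimum of the monotone affine maps `F_L`, attained only at `G`, and
evaluating `F` is a Newton-type linearisation whose slope is conjugation by the closed loop.

Detectability turns `F_L(K) ≤ K`, `K ≥ 0` into stability of `A + BL`; stability makes the Lyapunov
equation `X = D'XD + M` uniquely solvable by `∑ (D^i)'M D^i`, so signs and norm bounds pass from `M`
to `X`. This yields `K* ≤ K` on the region of decreasing, hence uniqueness; existence comes from
decreasing iterates of `F`.

The gap `K_L - K*` solves the Lyapunov equation with `M = (L - L*)'(B'K*B + R)(L - L*)`, with no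
term linear in `L - L*` because `L*` is a minimiser. Since the gain is Lipschitz in `K`, the gap is
quadratic in `K̄ - K*`. For MPC this is applied at `F^(ℓ-1)(K)`, whose distance to `K*` is
controlled by `β_ℓ`. -/

theorem l2_opNorm_transpose (M : Matrix (Fin n) (Fin m) ℝ) : ‖Mᵀ‖ = ‖M‖ := by
  rw [← Matrix.conjTranspose_eq_transpose_of_trivial, Matrix.l2_opNorm_conjTranspose]

theorem posSemidef_congr {X : Matrix (Fin n) (Fin n) ℝ} (hX : X.PosSemidef)
    (D : Matrix (Fin n) (Fin m) ℝ) : (Dᵀ * X * D).PosSemidef := by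
  simpa [Matrix.conjTranspose_eq_transpose_of_trivial] using hX.conjTranspose_mul_mul_same D

theorem transpose_mul_mul_mono {X Y : Matrix (Fin n) (Fin n) ℝ} (h : X ≤ Y)
    (D : Matrix (Fin n) (Fin m) ℝ) : Dᵀ * X * D ≤ Dᵀ * Y * D := by
  rw [Matrix.le_iff] at h ⊢
  simpa [mul_sub, sub_mul, Matrix.mul_sub, Matrix.sub_mul] using posSemidef_congr h D

theorem exists_eq_transpose_mul_self {X : Matrix (Fin n) (Fin n) ℝ} (hX : X.PosSemidef) :
    ∃ C : Matrix (Fin n) (Fin n) ℝ, X = Cᵀ * C := by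
  refine ⟨CFC.sqrt X, ?_⟩
  have h : (CFC.sqrt X)ᵀ = CFC.sqrt X := by
    rw [← Matrix.conjTranspose_eq_transpose_of_trivial]
    exact (Matrix.nonneg_iff_posSemidef.1 (CFC.sqrt_nonneg X)).isHermitian
  rw [h, CFC.sqrt_mul_sqrt_self X hX.nonneg]

/-- The induced `2`-norm is monotone on positive semidefinite matrices. -/
theorem norm_le_norm_of_posSemidef {X Y : Matrix (Fin n) (Fin n) ℝ} (hX : X.PosSemidef)
    (h : X ≤ Y) : ‖X‖ ≤ ‖Y‖ := by
  obtain ⟨C, rfl⟩ := exists_eq_transpose_mul_self hX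
  have hC : ‖Cᵀ * C‖ = ‖C‖ * ‖C‖ := by
    rw [← Matrix.conjTranspose_eq_transpose_of_trivial, Matrix.l2_opNorm_conjTranspose_mul_self]
  -- Pointwise, `|Cx|² = x'Xx ≤ x'Yx ≤ ‖Y‖|x|²`, while `‖X‖ = ‖C‖²`.
  have key : ‖C‖ ≤ Real.sqrt ‖Y‖ := by
    rw [Matrix.l2_opNorm_def]
    refine ContinuousLinearMap.opNorm_le_bound _ (Real.sqrt_nonneg _) fun x => ?_
    refine le_of_sq_le_sq ?_ (by positivity)
    rw [mul_pow, Real.sq_sqrt (norm_nonneg _)]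
    have h1 : ‖(Matrix.toEuclideanLin.trans LinearMap.toContinuousLinearMap) C x‖ ^ 2
        = x.ofLp ⬝ᵥ (Cᵀ * C) *ᵥ x.ofLp := by
      rw [EuclideanSpace.real_norm_sq_eq, ← Matrix.mulVec_mulVec, Matrix.dotProduct_mulVec,
        Matrix.vecMul_transpose]
      simp [dotProduct, sq, Matrix.toLpLin_apply]
    have h2 : x.ofLp ⬝ᵥ (Cᵀ * C) *ᵥ x.ofLp ≤ x.ofLp ⬝ᵥ Y *ᵥ x.ofLp := by
      have := (Matrix.le_iff.1 h).dotProduct_mulVec_nonneg x.ofLp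
      simpa [Matrix.sub_mulVec, dotProduct_sub] using this
    have h3 : x.ofLp ⬝ᵥ Y *ᵥ x.ofLp ≤ ‖x‖ * (‖Y‖ * ‖x‖) := by
      have h4 := real_inner_le_norm x (WithLp.toLp 2 (Y *ᵥ x.ofLp))
      have h5 := Matrix.l2_opNorm_mulVec Y x
      have h6 : inner ℝ x (WithLp.toLp 2 (Y *ᵥ x.ofLp)) = x.ofLp ⬝ᵥ Y *ᵥ x.ofLp := by
        simp [PiLp.inner_apply, dotProduct, mul_comm]
      rw [h6] at h4
      exact h4.trans (mul_le_mul_of_nonneg_left h5 (norm_nonneg _))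
    rw [h1]
    linarith [h2, h3]
  rw [hC]
  calc ‖C‖ * ‖C‖ ≤ Real.sqrt ‖Y‖ * Real.sqrt ‖Y‖ := by gcongr
    _ = ‖Y‖ := Real.mul_self_sqrt (norm_nonneg _)

theorem norm_transpose_mul_mul_le (M : Matrix (Fin n) (Fin n) ℝ) (D : Matrix (Fin n) (Fin m) ℝ) :
    ‖Dᵀ * M * D‖ ≤ ‖D‖ ^ 2 * ‖M‖ :=
  calc ‖Dᵀ * M * D‖ ≤ ‖Dᵀ * M‖ * ‖D‖ := Matrix.l2_opNorm_mul _ _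
    _ ≤ ‖Dᵀ‖ * ‖M‖ * ‖D‖ := by gcongr; exact Matrix.l2_opNorm_mul _ _
    _ = ‖D‖ ^ 2 * ‖M‖ := by rw [l2_opNorm_transpose]; ring

theorem isClosed_posSemidef : IsClosed {X : Matrix (Fin n) (Fin n) ℝ | X.PosSemidef} := by
  simp only [Matrix.posSemidef_iff_dotProduct_mulVec, Set.ofPred_and, Set.ofPred_forall]
  refine IsClosed.inter ?_ (isClosed_iInter fun x => ?_)
  · exact isClosed_eq (by fun_prop) (by fun_prop)
  · exact isClosed_le (by fun_prop) (by fun_prop)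

/-! ### Stability matrices and the discrete Lyapunov equation -/

/-- The powers of a stability matrix have square-summable norms. -/
theorem IsStabilityMatrix.summable {D : Matrix (Fin n) (Fin n) ℝ} (hD : IsStabilityMatrix D) :
    Summable fun i : ℕ => ‖D ^ i‖ ^ 2 := by
  -- Gelfand's formula is applied over `ℂ`; injectivity in finite dimension makes `φ` antilipschitz,
  -- which brings the bound back to real matrices at the cost of a factor `c`.
  let φ : Matrix (Fin n) (Fin n) ℝ →ₐ[ℝ] Matrix (Fin n) (Fin n) ℂ :=
    (Algebra.ofId ℝ ℂ).mapMatrix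
  have hφD : φ D = D.map (algebraMap ℝ ℂ) := rfl
  have hker : LinearMap.ker φ.toLinearMap = ⊥ := by
    rw [LinearMap.ker_eq_bot]
    intro X Y h
    ext i j
    have := congrFun (congrFun h i) j
    simpa [φ, Algebra.ofId_apply] using this
  obtain ⟨c, hc, hanti⟩ := φ.toLinearMap.exists_antilipschitzWith hker
  have hbound (X) : ‖X‖ ≤ c * ‖φ X‖ := by
    simpa [dist_zero_right] using hanti.le_mul_dist X 0
  have hrad : spectralRadius ℂ (φ D) < 1 := by
    rcases isEmpty_or_nonempty (Fin n) with hn | hn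
    · have : φ D = 0 := Subsingleton.elim _ _
      rw [this]
      simp
    · exact_mod_cast spectrum.spectralRadius_lt_of_forall_lt (φ D) (r := 1)
        fun z hz => by simpa [← NNReal.coe_lt_coe] using hD z (hφD ▸ hz)
  obtain ⟨r, hr1, hr2⟩ := ENNReal.lt_iff_exists_nnreal_btwn.1 hrad
  have hr2' : r < 1 := by exact_mod_cast hr2
  have hev := (spectrum.pow_nnnorm_pow_one_div_tendsto_nhds_spectralRadius (φ D)).eventually_lt_const
    hr1
  have hsum : Summable fun i : ℕ => ((c : ℝ) ^ 2) * ((r : ℝ) ^ 2) ^ i :=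
    (summable_geometric_of_lt_one (by positivity)
      (by have : (r : ℝ) < 1 := by exact_mod_cast hr2'
          nlinarith [r.coe_nonneg])).mul_left _
  refine hsum.of_norm_bounded_eventually_nat ?_
  filter_upwards [hev, Filter.eventually_gt_atTop 0] with i hi hi0
  have h1 : ‖φ D ^ i‖ ≤ (r : ℝ) ^ i := by
    have hi0' : (i : ℝ) ≠ 0 := by exact_mod_cast hi0.ne'
    have := ENNReal.rpow_le_rpow hi.le (Nat.cast_nonneg i : (0 : ℝ) ≤ i)
    rw [← ENNReal.rpow_mul, one_div_mul_cancel hi0', ENNReal.rpow_one, ENNReal.rpow_natCast] at this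
    exact_mod_cast this
  have h2 := hbound (D ^ i)
  rw [map_pow] at h2
  rw [Real.norm_of_nonneg (by positivity)]
  calc ‖D ^ i‖ ^ 2 ≤ (c * (r : ℝ) ^ i) ^ 2 := by
        gcongr
        exact h2.trans (by gcongr)
    _ = _ := by ring

theorem summable_lyapunov {D : Matrix (Fin n) (Fin n) ℝ} (hD : Summable fun i : ℕ => ‖D ^ i‖ ^ 2)
    (M : Matrix (Fin n) (Fin n) ℝ) : Summable fun i : ℕ => (D ^ i)ᵀ * M * D ^ i :=
  have := FiniteDimensional.complete ℝ (Matrix (Fin n) (Fin n) ℝ)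
  (hD.mul_right ‖M‖).of_norm_bounded fun i => norm_transpose_mul_mul_le M (D ^ i)

theorem tendsto_transpose_pow_mul_mul_pow {D : Matrix (Fin n) (Fin n) ℝ}
    (hD : Summable fun i : ℕ => ‖D ^ i‖ ^ 2) (M : Matrix (Fin n) (Fin n) ℝ) :
    Filter.Tendsto (fun i : ℕ => (D ^ i)ᵀ * M * D ^ i) Filter.atTop (nhds 0) :=
  (summable_lyapunov hD M).tendsto_atTop_zero

/-- A solution of the discrete Lyapunov equation is given by the Neumann series. -/
theorem hasSum_lyapunov {D X M : Matrix (Fin n) (Fin n) ℝ}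
    (hD : Summable fun i : ℕ => ‖D ^ i‖ ^ 2) (h : X = Dᵀ * X * D + M) :
    HasSum (fun i : ℕ => (D ^ i)ᵀ * M * D ^ i) X := by
  rw [(summable_lyapunov hD M).hasSum_iff_tendsto_nat]
  -- The sum telescopes once `M` is replaced by `X - D'XD`.
  have hpart (k : ℕ) : ∑ i ∈ Finset.range k, (D ^ i)ᵀ * M * D ^ i = X - (D ^ k)ᵀ * X * D ^ k := by
    induction k with
    | zero => simp
    | succ k ih =>
      have hM : M = X - Dᵀ * X * D := eq_sub_of_add_eq' h.symm
      rw [Finset.sum_range_succ, ih, pow_succ', hM, Matrix.transpose_mul]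
      have hc : D * D ^ k = D ^ k * D := (pow_succ' D k).symm.trans (pow_succ D k)
      simp only [Matrix.transpose_pow] at *
      have hc' : Dᵀ ^ k * Dᵀ = Dᵀ * Dᵀ ^ k := (pow_succ Dᵀ k).symm.trans (pow_succ' Dᵀ k)
      noncomm_ring
  simp only [hpart]
  simpa using tendsto_const_nhds.sub (tendsto_transpose_pow_mul_mul_pow hD X)

theorem exists_lyapunov {D : Matrix (Fin n) (Fin n) ℝ}
    (hD : Summable fun i : ℕ => ‖D ^ i‖ ^ 2) (M : Matrix (Fin n) (Fin n) ℝ) :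
    ∃! X, X = Dᵀ * X * D + M := by
  have hs := summable_lyapunov hD M
  refine ⟨∑' i : ℕ, (D ^ i)ᵀ * M * D ^ i, ?_, fun Y hY => (hasSum_lyapunov hD hY).tsum_eq.symm⟩
  have h1 : ∑' i : ℕ, (D ^ (i + 1))ᵀ * M * D ^ (i + 1)
      = Dᵀ * (∑' i : ℕ, (D ^ i)ᵀ * M * D ^ i) * D := by
    rw [← hs.tsum_mul_left, ← (hs.mul_left _).tsum_mul_right]
    refine tsum_congr fun i => ?_
    rw [pow_succ, Matrix.transpose_mul]
    noncomm_ring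
  beta_reduce
  rw [← h1]
  conv_lhs => rw [hs.tsum_eq_zero_add]
  simp [add_comm]

theorem posSemidef_of_hasSum {f : ℕ → Matrix (Fin n) (Fin n) ℝ} {X : Matrix (Fin n) (Fin n) ℝ}
    (hf : ∀ i, (f i).PosSemidef) (h : HasSum f X) : X.PosSemidef :=
  isClosed_posSemidef.mem_of_tendsto h
    (Filter.Eventually.of_forall fun s => Matrix.posSemidef_sum s fun i _ => hf i)

/-- `X` is the sum of the conjugates of `X - D'XD ≥ 0` by the powers of `D`, so its own sign need
not be known beforehand. -/
theorem posSemidef_of_lyapunov {D X : Matrix (Fin n) (Fin n) ℝ}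
    (hD : Summable fun i : ℕ => ‖D ^ i‖ ^ 2) (h : Dᵀ * X * D ≤ X) : X.PosSemidef :=
  posSemidef_of_hasSum (fun i => posSemidef_congr (Matrix.le_iff.1 h) (D ^ i))
    (hasSum_lyapunov hD (add_sub_cancel _ _).symm)

theorem norm_le_of_lyapunov {D X M : Matrix (Fin n) (Fin n) ℝ}
    (hD : Summable fun i : ℕ => ‖D ^ i‖ ^ 2) (h : X = Dᵀ * X * D + M) :
    ‖X‖ ≤ ‖M‖ * ∑' i : ℕ, ‖D ^ i‖ ^ 2 := by
  rw [← (hasSum_lyapunov hD h).tsum_eq, ← tsum_mul_left]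
  refine tsum_of_norm_bounded (hD.mul_left ‖M‖).hasSum fun i => ?_
  rw [mul_comm]
  exact norm_transpose_mul_mul_le M (D ^ i)

/-- A decreasing sequence of positive semidefinite matrices converges. -/
theorem exists_tendsto_of_antitone {f : ℕ → Matrix (Fin n) (Fin n) ℝ}
    (hf : ∀ k, (f k).PosSemidef) (hanti : Antitone f) :
    ∃ X, Filter.Tendsto f Filter.atTop (nhds X) := by
  -- Each quadratic form decreases and is bounded below by `0`; the entries of the limit are then
  -- recovered by polarisation.
  have hq (x : Fin n → ℝ) : ∃ a, Filter.Tendsto (fun k => x ⬝ᵥ f k *ᵥ x) Filter.atTop (nhds a) := by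
    refine ⟨_, tendsto_atTop_ciInf (fun j k hjk => ?_) ⟨0, ?_⟩⟩
    · have := (Matrix.le_iff.1 (hanti hjk)).dotProduct_mulVec_nonneg x
      simpa [Matrix.sub_mulVec, dotProduct_sub] using this
    · rintro _ ⟨k, rfl⟩
      simpa using (hf k).dotProduct_mulVec_nonneg x
  choose a ha using hq
  let e (i : Fin n) : Fin n → ℝ := Pi.single i 1
  refine ⟨Matrix.of fun i j => (a (e i + e j) - a (e i) - a (e j)) / 2, ?_⟩
  refine tendsto_pi_nhds.2 fun i => tendsto_pi_nhds.2 fun j => ?_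
  refine ((((ha (e i + e j)).sub (ha (e i))).sub (ha (e j))).div_const 2).congr fun k => ?_
  have hsymm : f k j i = f k i j := by simpa using (hf k).isHermitian.apply i j
  simp [e, Matrix.mulVec_add, add_dotProduct, dotProduct_add, hsymm]
  ring

theorem mem_spectrum_iff_exists_mulVec {M : Matrix (Fin n) (Fin n) ℂ} {z : ℂ} :
    z ∈ spectrum ℂ M ↔ ∃ v, v ≠ 0 ∧ M *ᵥ v = z • v := by
  rw [← Matrix.spectrum_toLin', ← Module.End.hasEigenvalue_iff_mem_spectrum]
  constructor
  · intro h
    obtain ⟨v, hv⟩ := h.exists_hasEigenvector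
    exact ⟨v, hv.2, by simpa using hv.apply_eq_smul⟩
  · rintro ⟨v, hv0, hv⟩
    exact Module.End.hasEigenvalue_of_hasEigenvector (x := v)
      ⟨Module.End.mem_eigenspace_iff.2 (by simpa using hv), hv0⟩

/-! ### The Bellman operators and the Riccati equation -/

section RiccatiOperator

variable {A : Matrix (Fin n) (Fin n) ℝ} {B : Matrix (Fin n) (Fin m) ℝ}
  {Q : Matrix (Fin n) (Fin n) ℝ} {R : Matrix (Fin m) (Fin m) ℝ}

theorem posDef_transpose_mul_mul_add (hR : R.PosDef) {K : Matrix (Fin n) (Fin n) ℝ}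
    (hK : K.PosSemidef) : (Bᵀ * K * B + R).PosDef :=
  hR.posSemidef_add (posSemidef_congr hK B)

theorem transpose_eq_of_posSemidef {K : Matrix (Fin n) (Fin n) ℝ} (hK : K.PosSemidef) :
    Kᵀ = K := by
  rw [← Matrix.conjTranspose_eq_transpose_of_trivial]
  exact hK.isHermitian

theorem mul_riccatiGain (hR : R.PosDef) {K : Matrix (Fin n) (Fin n) ℝ} (hK : K.PosSemidef) :
    (Bᵀ * K * B + R) * riccatiGain A B R K = -(Bᵀ * K * A) := by
  have hS : IsUnit (Bᵀ * K * B + R).det :=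
    (Matrix.isUnit_iff_isUnit_det _).1 (posDef_transpose_mul_mul_add hR hK).isUnit
  rw [riccatiGain, Matrix.mul_neg, Matrix.mul_assoc _ Bᵀ, Matrix.mul_assoc _ (Bᵀ * K),
    Matrix.mul_nonsing_inv_cancel_left _ _ hS]

/-- Completion of squares: the Bellman operator is the minimum of the `L`-Bellman operators. -/
theorem gainBellman_eq_bellman_add (hR : R.PosDef) {K : Matrix (Fin n) (Fin n) ℝ}
    (hK : K.PosSemidef) (L : Matrix (Fin m) (Fin n) ℝ) :
    gainBellman A B Q R L K = bellman A B Q R K +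
      (L - riccatiGain A B R K)ᵀ * (Bᵀ * K * B + R) * (L - riccatiGain A B R K) := by
  have hS := transpose_eq_of_posSemidef (posDef_transpose_mul_mul_add (B := B) hR hK).posSemidef
  have h1 := mul_riccatiGain (A := A) (B := B) hR hK
  have h2 : (riccatiGain A B R K)ᵀ * (Bᵀ * K * B + R) = -(Aᵀ * K * B) := by
    have := congrArg Matrix.transpose h1
    rw [Matrix.transpose_mul, hS] at this
    rw [this]
    simp [Matrix.transpose_mul, transpose_eq_of_posSemidef hK, Matrix.mul_assoc]
  have h3 : bellman A B Q R K = Aᵀ * K * A + Aᵀ * K * B * riccatiGain A B R K + Q := by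
    simp only [bellman, riccatiGain, Matrix.mul_sub, Matrix.sub_mul, Matrix.mul_neg,
      Matrix.mul_assoc]
    abel
  rw [h3]
  have h4 : (L - riccatiGain A B R K)ᵀ * (Bᵀ * K * B + R) * (L - riccatiGain A B R K)
      = Lᵀ * (Bᵀ * K * B + R) * L - Lᵀ * ((Bᵀ * K * B + R) * riccatiGain A B R K)
        - (riccatiGain A B R K)ᵀ * (Bᵀ * K * B + R) * L
        + (riccatiGain A B R K)ᵀ * (Bᵀ * K * B + R) * riccatiGain A B R K := by
    rw [Matrix.transpose_sub]
    simp only [Matrix.mul_sub, Matrix.sub_mul, Matrix.mul_assoc]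
    abel
  rw [h4, h1, h2]
  simp only [gainBellman, Matrix.transpose_add, Matrix.transpose_mul, Matrix.mul_add,
    Matrix.add_mul, Matrix.mul_neg, Matrix.neg_mul, Matrix.mul_assoc]
  abel

theorem bellman_le_gainBellman (hR : R.PosDef) {K : Matrix (Fin n) (Fin n) ℝ}
    (hK : K.PosSemidef) (L : Matrix (Fin m) (Fin n) ℝ) :
    bellman A B Q R K ≤ gainBellman A B Q R L K := by
  rw [gainBellman_eq_bellman_add hR hK, Matrix.le_iff, add_sub_cancel_left]
  exact posSemidef_congr (posDef_transpose_mul_mul_add hR hK).posSemidef _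

theorem gainBellman_riccatiGain (hR : R.PosDef) {K : Matrix (Fin n) (Fin n) ℝ}
    (hK : K.PosSemidef) :
    gainBellman A B Q R (riccatiGain A B R K) K = bellman A B Q R K := by
  simp [gainBellman_eq_bellman_add hR hK]

/-- The square in the completed form has a positive definite weight, so it vanishes only for a zero
gain difference. This gives uniqueness of the MPC gain. -/
theorem gainBellman_eq_bellman_iff (hR : R.PosDef) {K : Matrix (Fin n) (Fin n) ℝ}
    (hK : K.PosSemidef) {L : Matrix (Fin m) (Fin n) ℝ} :
    gainBellman A B Q R L K = bellman A B Q R K ↔ L = riccatiGain A B R K := by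
  refine ⟨fun h => ?_, fun h => h ▸ gainBellman_riccatiGain hR hK⟩
  rw [gainBellman_eq_bellman_add hR hK, add_eq_left] at h
  have hS := posDef_transpose_mul_mul_add (B := B) hR hK
  rw [← sub_eq_zero]
  set Δ := L - riccatiGain A B R K
  by_contra hΔ
  obtain ⟨x, hx⟩ : ∃ x, Δ *ᵥ x ≠ 0 := by
    by_contra! hall
    exact hΔ (Matrix.ext_of_mulVec_single fun i => by rw [hall, Matrix.zero_mulVec])
  have hpos := hS.dotProduct_mulVec_pos hx
  have hzero : x ⬝ᵥ (Δᵀ * (Bᵀ * K * B + R) * Δ) *ᵥ x = 0 := by simp [h]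
  rw [← Matrix.mulVec_mulVec, ← Matrix.mulVec_mulVec, Matrix.dotProduct_mulVec,
    Matrix.vecMul_transpose] at hzero
  simp only [star_trivial] at hpos
  exact hpos.ne' hzero

theorem gainBellman_sub_gainBellman (L : Matrix (Fin m) (Fin n) ℝ)
    (X Y : Matrix (Fin n) (Fin n) ℝ) :
    gainBellman A B Q R L X - gainBellman A B Q R L Y = (A + B * L)ᵀ * (X - Y) * (A + B * L) := by
  simp only [gainBellman, Matrix.mul_sub, Matrix.sub_mul]
  abel

theorem gainBellman_mono (L : Matrix (Fin m) (Fin n) ℝ) :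
    Monotone (gainBellman A B Q R L) := fun X Y h => by
  rw [Matrix.le_iff, gainBellman_sub_gainBellman]
  exact posSemidef_congr (Matrix.le_iff.1 h) _

/-- The minimising gain of `Y` is merely admissible for `X`. -/
theorem bellman_mono (hR : R.PosDef) {X Y : Matrix (Fin n) (Fin n) ℝ} (hX : X.PosSemidef)
    (hY : Y.PosSemidef) (h : X ≤ Y) : bellman A B Q R X ≤ bellman A B Q R Y :=
  calc bellman A B Q R X ≤ gainBellman A B Q R (riccatiGain A B R Y) X :=
        bellman_le_gainBellman hR hX _
    _ ≤ gainBellman A B Q R (riccatiGain A B R Y) Y := gainBellman_mono _ h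
    _ = bellman A B Q R Y := gainBellman_riccatiGain hR hY

theorem posSemidef_gainBellman (hQ : Q.PosSemidef) (hR : R.PosDef)
    {K : Matrix (Fin n) (Fin n) ℝ} (hK : K.PosSemidef) (L : Matrix (Fin m) (Fin n) ℝ) :
    (gainBellman A B Q R L K).PosSemidef :=
  ((posSemidef_congr hK _).add hQ).add (posSemidef_congr hR.posSemidef L)

theorem posSemidef_bellman (hQ : Q.PosSemidef) (hR : R.PosDef)
    {K : Matrix (Fin n) (Fin n) ℝ} (hK : K.PosSemidef) : (bellman A B Q R K).PosSemidef :=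
  gainBellman_riccatiGain (Q := Q) hR hK ▸ posSemidef_gainBellman hQ hR hK _

theorem bellman_mem_regionOfDecreasing (hQ : Q.PosSemidef) (hR : R.PosDef)
    {K : Matrix (Fin n) (Fin n) ℝ} (hK : K ∈ regionOfDecreasing A B Q R) :
    bellman A B Q R K ∈ regionOfDecreasing A B Q R :=
  have hF := posSemidef_bellman (A := A) (B := B) hQ hR hK.1
  ⟨hF, bellman_mono hR hF hK.1 hK.2⟩

theorem iterate_bellman_mem_regionOfDecreasing (hQ : Q.PosSemidef) (hR : R.PosDef)
    {K : Matrix (Fin n) (Fin n) ℝ} (hK : K ∈ regionOfDecreasing A B Q R) (k : ℕ) :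
    (bellman A B Q R)^[k] K ∈ regionOfDecreasing A B Q R := by
  induction k with
  | zero => exact hK
  | succ k ih =>
    rw [Function.iterate_succ_apply']
    exact bellman_mem_regionOfDecreasing hQ hR ih

theorem antitone_iterate_bellman (hQ : Q.PosSemidef) (hR : R.PosDef)
    {K : Matrix (Fin n) (Fin n) ℝ} (hK : K ∈ regionOfDecreasing A B Q R) :
    Antitone fun k => (bellman A B Q R)^[k] K :=
  antitone_nat_of_succ_le fun k => by
    rw [Function.iterate_succ_apply']
    exact (iterate_bellman_mem_regionOfDecreasing hQ hR hK k).2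

open ComplexOrder in
/-- A positive semidefinite `K` with `F_L(K) ≤ K` certifies stability of the closed loop, by
detectability. -/
theorem isStabilityMatrix_of_gainBellman_le (hQ : Q.PosSemidef) (hR : R.PosDef)
    (hAQ : Detectable A (CFC.sqrt Q)) {K : Matrix (Fin n) (Fin n) ℝ} (hK : K.PosSemidef)
    {L : Matrix (Fin m) (Fin n) ℝ} (h : gainBellman A B Q R L K ≤ K) :
    IsStabilityMatrix (A + B * L) := by
  intro z hz
  obtain ⟨v, hv0, hv⟩ := mem_spectrum_iff_exists_mulVec.1 hz
  by_contra hz1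
  obtain ⟨G, hG⟩ := hAQ
  -- An eigenvector `v` for `|z| ≥ 1` will satisfy `√Q v = 0` and `Lv = 0`. The closed loop and `A +
  -- G√Q` then both act on it as `A`, so `z` is an eigenvalue of the latter, against detectability.
  refine hz1 (hG z (mem_spectrum_iff_exists_mulVec.2 ⟨v, hv0, ?_⟩))
  let c : ℝ →+* ℂ := algebraMap ℝ ℂ
  have hc : ∀ x : ℝ, c x = (x : ℂ) := fun x => rfl
  have hcT {k l : ℕ} (M : Matrix (Fin k) (Fin l) ℝ) : (Mᵀ).map c = (M.map c)ᴴ := by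
    ext i j
    simp [hc]
  have hsq {k l : ℕ} (M : Matrix (Fin k) (Fin l) ℝ) (w : Fin l → ℂ) :
      star w ⬝ᵥ ((Mᵀ * M).map c) *ᵥ w = star (M.map c *ᵥ w) ⬝ᵥ (M.map c *ᵥ w) := by
    rw [Matrix.map_mul, ← Matrix.mulVec_mulVec, hcT, Matrix.dotProduct_mulVec, Matrix.star_mulVec]
  have hnn {k : ℕ} (w : Fin k → ℂ) : 0 ≤ star w ⬝ᵥ w := dotProduct_star_self_nonneg w
  have hconj {k : ℕ} (X : Matrix (Fin k) (Fin k) ℝ) (M : Matrix (Fin k) (Fin n) ℝ) :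
      star v ⬝ᵥ ((Mᵀ * X * M).map c) *ᵥ v
        = star (M.map c *ᵥ v) ⬝ᵥ (X.map c) *ᵥ (M.map c *ᵥ v) := by
    rw [Matrix.map_mul, Matrix.map_mul, ← Matrix.mulVec_mulVec, ← Matrix.mulVec_mulVec, hcT,
      Matrix.dotProduct_mulVec, Matrix.star_mulVec]
  obtain ⟨K₁, hK₁⟩ := exists_eq_transpose_mul_self hK
  obtain ⟨R₁, hR₁⟩ := exists_eq_transpose_mul_self hR.posSemidef
  obtain ⟨P₁, hP₁⟩ := exists_eq_transpose_mul_self (Matrix.le_iff.1 h)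
  have hQ₁ : Q = (CFC.sqrt Q)ᵀ * CFC.sqrt Q := by
    rw [transpose_eq_of_posSemidef (Matrix.nonneg_iff_posSemidef.1 (CFC.sqrt_nonneg Q)),
      CFC.sqrt_mul_sqrt_self Q hQ.nonneg]
  set W := CFC.sqrt Q
  -- Evaluated at `v`, this reads `(1 - |z|²)|K₁v|² = |√Q v|² + |R₁Lv|² + |P₁v|²`, where `P₁'P₁` is
  -- the slack in `F_L(K) ≤ K`. The left side is nonpositive, so every square on the right vanishes.
  have hdec : K = (A + B * L)ᵀ * K * (A + B * L) + Q + Lᵀ * R * L + P₁ᵀ * P₁ := by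
    rw [← hP₁, gainBellman]
    abel
  have hquad := congrArg (fun X : Matrix (Fin n) (Fin n) ℝ => star v ⬝ᵥ (X.map c) *ᵥ v) hdec
  simp only [Matrix.map_add c (map_add c), Matrix.add_mulVec, dotProduct_add, hconj] at hquad
  rw [show (B * L).map c = (B * L).map (algebraMap ℝ ℂ) from rfl] at hquad
  have hv' : (A.map c + (B * L).map (algebraMap ℝ ℂ)) *ᵥ v = z • v := by
    rw [← hv, Matrix.map_add _ (map_add _)]
  rw [← Matrix.add_mulVec, hv', hK₁, hQ₁, hR₁] at hquad
  simp only [hsq, Matrix.mulVec_smul, star_smul, smul_dotProduct, dotProduct_smul] at hquad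
  have hzz : z * star z = ((‖z‖ ^ 2 : ℝ) : ℂ) := by
    rw [Complex.star_def, Complex.mul_conj']
    push_cast
    rfl
  simp only [smul_eq_mul, ← mul_assoc, hzz] at hquad
  have hre := congrArg Complex.re hquad
  simp only [Complex.add_re, Complex.re_ofReal_mul] at hre
  have hnre {k : ℕ} (w : Fin k → ℂ) : 0 ≤ (star w ⬝ᵥ w).re := (Complex.nonneg_iff.1 (hnn w)).1
  have hzero {k : ℕ} (w : Fin k → ℂ) (hw : (star w ⬝ᵥ w).re ≤ 0) : w = 0 := by
    rw [← dotProduct_star_self_eq_zero (v := w)]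
    have h0 := Complex.nonneg_iff.1 (hnn w)
    exact Complex.ext (le_antisymm hw (hnre w)) h0.2.symm
  have hz2 : 1 ≤ ‖z‖ ^ 2 := one_le_pow₀ (not_lt.1 hz1)
  have hb1 := hnre (K₁.map c *ᵥ v)
  have hb2 := hnre (W.map c *ᵥ v)
  have hb3 := hnre (R₁.map c *ᵥ (L.map c *ᵥ v))
  have hb4 := hnre (P₁.map c *ᵥ v)
  have hmono := mul_le_mul_of_nonneg_right hz2 hb1
  have hW : W.map c *ᵥ v = 0 := hzero _ (by linarith)
  have hRL : R₁.map c *ᵥ (L.map c *ᵥ v) = 0 := hzero _ (by linarith)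
  have hL : L.map c *ᵥ v = 0 := by
    have h1 : (R⁻¹ * R).map c *ᵥ (L.map c *ᵥ v) = 0 := by
      conv_lhs => rw [hR₁]
      rw [Matrix.map_mul, Matrix.map_mul, ← Matrix.mulVec_mulVec, ← Matrix.mulVec_mulVec, hRL]
      simp
    rw [Matrix.nonsing_inv_mul _ ((Matrix.isUnit_iff_isUnit_det _).1 hR.isUnit)] at h1
    simpa [Matrix.map_one] using h1
  change ((A + G * W).map c) *ᵥ v = z • v
  rw [← hv]
  change _ = ((A + B * L).map c) *ᵥ v
  rw [Matrix.map_add c (map_add c), Matrix.map_add c (map_add c), Matrix.map_mul, Matrix.map_mul,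
    Matrix.add_mulVec, Matrix.add_mulVec, ← Matrix.mulVec_mulVec, ← Matrix.mulVec_mulVec, hW, hL]
  simp

theorem isStabilityMatrix_riccatiGain (hQ : Q.PosSemidef) (hR : R.PosDef)
    (hAQ : Detectable A (CFC.sqrt Q)) {K : Matrix (Fin n) (Fin n) ℝ}
    (hK : K ∈ regionOfDecreasing A B Q R) :
    IsStabilityMatrix (A + B * riccatiGain A B R K) :=
  isStabilityMatrix_of_gainBellman_le hQ hR hAQ hK.1 (by
    rw [gainBellman_riccatiGain hR hK.1]
    exact hK.2)

theorem IsRiccatiSolution.mem_regionOfDecreasing {K : Matrix (Fin n) (Fin n) ℝ}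
    (hK : IsRiccatiSolution A B Q R K) : K ∈ regionOfDecreasing A B Q R :=
  ⟨hK.1, by rw [← hK.2, sub_self]; exact .zero⟩

/-- Every Riccati solution is a lower bound of the region of decreasing. -/
theorem IsRiccatiSolution.le (hQ : Q.PosSemidef) (hR : R.PosDef)
    (hAQ : Detectable A (CFC.sqrt Q)) {Kstar K : Matrix (Fin n) (Fin n) ℝ}
    (hs : IsRiccatiSolution A B Q R Kstar) (hK : K ∈ regionOfDecreasing A B Q R) : Kstar ≤ K := by
  rw [Matrix.le_iff]
  -- With `L` the gain of `K`: `F_L(K) = F(K) ≤ K` and `F_L(K*) ≥ F(K*) = K*`, so conjugating `K -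
  -- K*` by the stable closed loop decreases it.
  refine posSemidef_of_lyapunov (isStabilityMatrix_riccatiGain hQ hR hAQ hK).summable ?_
  rw [← gainBellman_sub_gainBellman (Q := Q) (R := R)]
  refine sub_le_sub ?_ ?_
  · rw [gainBellman_riccatiGain hR hK.1]
    exact hK.2
  · conv_lhs => rw [hs.2]
    exact bellman_le_gainBellman hR hs.1 _

theorem existsUnique_gainBellman_fixedPoint {L : Matrix (Fin m) (Fin n) ℝ}
    (hL : IsStabilityMatrix (A + B * L)) : ∃! K, K = gainBellman A B Q R L K := by
  simpa only [gainBellman, add_assoc] using exists_lyapunov hL.summable (Q + Lᵀ * R * L)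

theorem posSemidef_of_eq_gainBellman (hQ : Q.PosSemidef) (hR : R.PosDef)
    {L : Matrix (Fin m) (Fin n) ℝ} (hL : IsStabilityMatrix (A + B * L))
    {K : Matrix (Fin n) (Fin n) ℝ} (hK : K = gainBellman A B Q R L K) : K.PosSemidef := by
  refine posSemidef_of_lyapunov hL.summable ?_
  rw [Matrix.le_iff]
  have h : K - (A + B * L)ᵀ * K * (A + B * L) = Q + Lᵀ * R * L := by
    conv_lhs => enter [1]; rw [hK]
    simp only [gainBellman]
    abel
  rw [h]
  exact hQ.add (posSemidef_congr hR.posSemidef L)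

theorem continuousAt_bellman (hR : R.PosDef) {K : Matrix (Fin n) (Fin n) ℝ} (hK : K.PosSemidef) :
    ContinuousAt (bellman A B Q R) K := by
  have := FiniteDimensional.complete ℝ (Matrix (Fin m) (Fin m) ℝ)
  have hinv : ContinuousAt (fun X : Matrix (Fin n) (Fin n) ℝ => (Bᵀ * X * B + R)⁻¹) K := by
    obtain ⟨u, hu⟩ := (posDef_transpose_mul_mul_add (B := B) hR hK).isUnit
    have h1 : ContinuousAt Ring.inverse (Bᵀ * K * B + R) := hu ▸ NormedRing.inverse_continuousAt u
    have h2 : ContinuousAt (fun X : Matrix (Fin n) (Fin n) ℝ => Bᵀ * X * B + R) K :=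
      Continuous.continuousAt (by fun_prop)
    simpa [Function.comp_def, Matrix.nonsing_inv_eq_ringInverse] using
      ContinuousAt.comp (f := fun X : Matrix (Fin n) (Fin n) ℝ => Bᵀ * X * B + R) h1 h2
  have hmul {a b d : ℕ} {f : Matrix (Fin n) (Fin n) ℝ → Matrix (Fin a) (Fin b) ℝ}
      {g : Matrix (Fin n) (Fin n) ℝ → Matrix (Fin b) (Fin d) ℝ} (hf : ContinuousAt f K)
      (hg : ContinuousAt g K) : ContinuousAt (fun X => f X * g X) K :=
    (show Continuous fun x : Matrix (Fin a) (Fin b) ℝ × Matrix (Fin b) (Fin d) ℝ => x.1 * x.2 by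
      fun_prop).continuousAt.comp (hf.prodMk hg)
  have hid : ContinuousAt (fun X : Matrix (Fin n) (Fin n) ℝ => X) K := continuousAt_id
  exact (hmul (hmul continuousAt_const (hid.sub
    (hmul (hmul (hmul (hmul hid continuousAt_const) hinv) continuousAt_const) hid)))
      continuousAt_const).add continuousAt_const

/-- The cost `K_L` of a stabilizing gain satisfies `F(K_L) ≤ F_L(K_L) = K_L`. Its iterates under `F`
therefore decrease to a limit, which is fixed by continuity. -/
theorem exists_isRiccatiSolution (hQ : Q.PosSemidef) (hR : R.PosDef) (hAB : Stabilizable A B) :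
    ∃ K, IsRiccatiSolution A B Q R K := by
  obtain ⟨L, hL⟩ := hAB
  obtain ⟨K, hK, -⟩ := existsUnique_gainBellman_fixedPoint (Q := Q) (R := R) hL
  have hKpsd := posSemidef_of_eq_gainBellman hQ hR hL hK
  have hKmem : K ∈ regionOfDecreasing A B Q R :=
    ⟨hKpsd, (bellman_le_gainBellman hR hKpsd L).trans_eq hK.symm⟩
  have hpsd (k : ℕ) := (iterate_bellman_mem_regionOfDecreasing hQ hR hKmem k).1
  obtain ⟨X, hX⟩ := exists_tendsto_of_antitone hpsd (antitone_iterate_bellman hQ hR hKmem)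
  have hXpsd : X.PosSemidef := isClosed_posSemidef.mem_of_tendsto hX (Filter.Eventually.of_forall hpsd)
  refine ⟨X, hXpsd, tendsto_nhds_unique ((Filter.tendsto_add_atTop_iff_nat 1).2 hX) ?_⟩
  simpa only [Function.iterate_succ_apply', Function.comp_def] using
    (continuousAt_bellman hR hXpsd).tendsto.comp hX

/-- Each solution lies in the region of decreasing and bounds that region from below, so any two
bound each other. -/
theorem existsUnique_isRiccatiSolution (hQ : Q.PosSemidef) (hR : R.PosDef)
    (hAB : Stabilizable A B) (hAQ : Detectable A (CFC.sqrt Q)) :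
    ∃! K, IsRiccatiSolution A B Q R K := by
  obtain ⟨K, hK⟩ := exists_isRiccatiSolution hQ hR hAB
  exact ⟨K, hK, fun K' hK' => le_antisymm (hK'.le hQ hR hAQ hK.mem_regionOfDecreasing)
    (hK.le hQ hR hAQ hK'.mem_regionOfDecreasing)⟩

end RiccatiOperator

/-! ### Quadratic estimate for the Newton step and the MPC gain -/

section NewtonStep

variable {A : Matrix (Fin n) (Fin n) ℝ} {B : Matrix (Fin n) (Fin m) ℝ}
  {Q : Matrix (Fin n) (Fin n) ℝ} {R : Matrix (Fin m) (Fin m) ℝ}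

theorem norm_riccatiGain_sub_riccatiGain_le (hR : R.PosDef) {Kstar K : Matrix (Fin n) (Fin n) ℝ}
    (hs : Kstar.PosSemidef) (hK : K.PosSemidef) :
    ‖riccatiGain A B R K - riccatiGain A B R Kstar‖ ≤ newtonEta A B R Kstar K * ‖K - Kstar‖ := by
  have hSs : IsUnit (Bᵀ * Kstar * B + R).det :=
    (Matrix.isUnit_iff_isUnit_det _).1 (posDef_transpose_mul_mul_add hR hs).isUnit
  have h1 := mul_riccatiGain (A := A) (B := B) hR hK
  have h2 := mul_riccatiGain (A := A) (B := B) hR hs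
  have hG : riccatiGain A B R K = -((Bᵀ * K * B + R)⁻¹ * (Bᵀ * K * A)) := by
    simp only [riccatiGain, Matrix.mul_assoc]
  -- Subtracting the equations `(B'KB + R)G = -B'KA` for `K` and `K*` leaves a factor `K - K*` in
  -- every term; taking norms yields `η`.
  have hdiff : riccatiGain A B R K - riccatiGain A B R Kstar = (Bᵀ * Kstar * B + R)⁻¹ *
      (Bᵀ * (K - Kstar) * B * ((Bᵀ * K * B + R)⁻¹ * (Bᵀ * K * A)) - Bᵀ * (K - Kstar) * A) := by
    rw [← Matrix.nonsing_inv_mul_cancel_left _ (riccatiGain A B R K - riccatiGain A B R Kstar) hSs]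
    congr 1
    rw [Matrix.mul_sub, h2]
    have h3 : Bᵀ * Kstar * B + R = (Bᵀ * K * B + R) - Bᵀ * (K - Kstar) * B := by
      simp only [Matrix.mul_sub, Matrix.sub_mul]
      abel
    rw [h3, Matrix.sub_mul, h1, hG]
    simp only [Matrix.mul_sub, Matrix.sub_mul, Matrix.mul_neg]
    abel
  have hBA : ‖Bᵀ * (K - Kstar) * A‖ ≤ ‖Bᵀ‖ * ‖K - Kstar‖ * ‖A‖ :=
    (Matrix.l2_opNorm_mul _ _).trans (by gcongr; exact Matrix.l2_opNorm_mul _ _)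
  have hBB : ‖Bᵀ * (K - Kstar) * B‖ ≤ ‖Bᵀ‖ * ‖K - Kstar‖ * ‖B‖ :=
    (Matrix.l2_opNorm_mul _ _).trans (by gcongr; exact Matrix.l2_opNorm_mul _ _)
  rw [hdiff]
  calc _ ≤ ‖(Bᵀ * Kstar * B + R)⁻¹‖ *
        (‖Bᵀ * (K - Kstar) * B‖ * (‖(Bᵀ * K * B + R)⁻¹‖ * ‖Bᵀ * K * A‖)
          + ‖Bᵀ * (K - Kstar) * A‖) := by
        refine (Matrix.l2_opNorm_mul _ _).trans ?_
        gcongr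
        refine (norm_sub_le _ _).trans ?_
        gcongr
        refine (Matrix.l2_opNorm_mul _ _).trans ?_
        gcongr
        exact Matrix.l2_opNorm_mul _ _
    _ ≤ ‖(Bᵀ * Kstar * B + R)⁻¹‖ *
        (‖Bᵀ‖ * ‖K - Kstar‖ * ‖B‖ * (‖(Bᵀ * K * B + R)⁻¹‖ * ‖Bᵀ * K * A‖)
          + ‖Bᵀ‖ * ‖K - Kstar‖ * ‖A‖) := by gcongr
    _ = newtonEta A B R Kstar K * ‖K - Kstar‖ := by
        rw [newtonEta]
        ring

/-- Compare `K_L = F_L(K_L)` with the completed square `F_L(K*) = K* + (L - L*)'(B'K*B + R)(L -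
L*)`. -/
theorem sub_eq_of_eq_gainBellman (hR : R.PosDef) {Kstar : Matrix (Fin n) (Fin n) ℝ}
    (hs : IsRiccatiSolution A B Q R Kstar) {L : Matrix (Fin m) (Fin n) ℝ}
    {KL : Matrix (Fin n) (Fin n) ℝ} (hKL : KL = gainBellman A B Q R L KL) :
    KL - Kstar = (A + B * L)ᵀ * (KL - Kstar) * (A + B * L) +
      (L - riccatiGain A B R Kstar)ᵀ * (Bᵀ * Kstar * B + R) * (L - riccatiGain A B R Kstar) := by
  rw [← gainBellman_sub_gainBellman (Q := Q) (R := R), ← hKL,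
    gainBellman_eq_bellman_add hR hs.1, ← hs.2]
  abel

/-- The quadratic estimate for one Newton step of the Riccati equation. -/
theorem norm_sub_le_newtonGamma (hQ : Q.PosSemidef) (hR : R.PosDef)
    (hAQ : Detectable A (CFC.sqrt Q)) {Kstar K : Matrix (Fin n) (Fin n) ℝ}
    (hs : IsRiccatiSolution A B Q R Kstar) (hK : K ∈ regionOfDecreasing A B Q R)
    {L : Matrix (Fin m) (Fin n) ℝ} (hL : gainBellman A B Q R L K = bellman A B Q R K)
    {KL : Matrix (Fin n) (Fin n) ℝ} (hKL : KL = gainBellman A B Q R L KL) :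
    ‖KL - Kstar‖ ≤ newtonGamma A B R Kstar K L * ‖K - Kstar‖ ^ 2 := by
  obtain rfl := (gainBellman_eq_bellman_iff hR hK.1).1 hL
  have hstab := isStabilityMatrix_riccatiGain hQ hR hAQ hK
  have h1 := norm_le_of_lyapunov hstab.summable (sub_eq_of_eq_gainBellman hR hs hKL)
  have h2 := norm_riccatiGain_sub_riccatiGain_le (A := A) (B := B) hR hs.1 hK.1
  have h3 : (0 : ℝ) ≤ ∑' i : ℕ, ‖(A + B * riccatiGain A B R K) ^ i‖ ^ 2 :=
    tsum_nonneg fun i => by positivity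
  set Δ := riccatiGain A B R K - riccatiGain A B R Kstar
  have h4 : ‖Δᵀ * (Bᵀ * Kstar * B + R) * Δ‖ ≤ ‖Δ‖ ^ 2 * ‖Bᵀ * Kstar * B + R‖ :=
    calc _ ≤ ‖Δᵀ * (Bᵀ * Kstar * B + R)‖ * ‖Δ‖ := Matrix.l2_opNorm_mul _ _
      _ ≤ ‖Δᵀ‖ * ‖Bᵀ * Kstar * B + R‖ * ‖Δ‖ := by gcongr; exact Matrix.l2_opNorm_mul _ _
      _ = _ := by rw [l2_opNorm_transpose]; ring
  calc _ ≤ _ := h1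
    _ ≤ (newtonEta A B R Kstar K * ‖K - Kstar‖) ^ 2 * ‖Bᵀ * Kstar * B + R‖ *
        ∑' i : ℕ, ‖(A + B * riccatiGain A B R K) ^ i‖ ^ 2 := by
        gcongr
        refine h4.trans ?_
        gcongr
    _ = _ := by
        rw [newtonGamma]
        ring

theorem newtonGamma_nonneg (Kstar K : Matrix (Fin n) (Fin n) ℝ) (L : Matrix (Fin m) (Fin n) ℝ) :
    0 ≤ newtonGamma A B R Kstar K L := by
  have h : (0 : ℝ) ≤ ∑' i : ℕ, ‖(A + B * L) ^ i‖ ^ 2 := tsum_nonneg fun i => by positivity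
  unfold newtonGamma
  positivity

/-- The gain `L*` is exact at `K*` and suboptimal at the iterate, so each application of `F` costs
at most one conjugation by `A + BL*`. -/
theorem iterate_bellman_sub_le (hQ : Q.PosSemidef) (hR : R.PosDef)
    {Kstar K : Matrix (Fin n) (Fin n) ℝ} (hs : IsRiccatiSolution A B Q R Kstar)
    (hK : K ∈ regionOfDecreasing A B Q R) (k : ℕ) :
    (bellman A B Q R)^[k] K - Kstar ≤ ((A + B * riccatiGain A B R Kstar) ^ k)ᵀ * (K - Kstar) *
      (A + B * riccatiGain A B R Kstar) ^ k := by
  induction k with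
  | zero => simp
  | succ k ih =>
    have hpsd := (iterate_bellman_mem_regionOfDecreasing hQ hR hK k).1
    rw [Function.iterate_succ_apply']
    calc bellman A B Q R ((bellman A B Q R)^[k] K) - Kstar
        ≤ gainBellman A B Q R (riccatiGain A B R Kstar) ((bellman A B Q R)^[k] K)
          - gainBellman A B Q R (riccatiGain A B R Kstar) Kstar := by
          rw [gainBellman_riccatiGain hR hs.1, ← hs.2]
          exact sub_le_sub_right (bellman_le_gainBellman hR hpsd _) _
      _ = (A + B * riccatiGain A B R Kstar)ᵀ * ((bellman A B Q R)^[k] K - Kstar) *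
          (A + B * riccatiGain A B R Kstar) := gainBellman_sub_gainBellman _ _ _
      _ ≤ (A + B * riccatiGain A B R Kstar)ᵀ * (((A + B * riccatiGain A B R Kstar) ^ k)ᵀ *
          (K - Kstar) * (A + B * riccatiGain A B R Kstar) ^ k) *
          (A + B * riccatiGain A B R Kstar) := transpose_mul_mul_mono ih _
      _ = _ := by
          rw [pow_succ, Matrix.transpose_mul]
          simp only [Matrix.mul_assoc]

/-- The two entries of the minimum come from conjugation by powers of `A + BL*` and from the
decrease of the iterates. Norm monotonicity applies since the iterate stays above `K*`. -/
theorem norm_iterate_bellman_sub_le (hQ : Q.PosSemidef) (hR : R.PosDef)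
    (hAQ : Detectable A (CFC.sqrt Q)) {Kstar K : Matrix (Fin n) (Fin n) ℝ}
    (hs : IsRiccatiSolution A B Q R Kstar) (hK : K ∈ regionOfDecreasing A B Q R) (ℓ : ℕ) :
    ‖(bellman A B Q R)^[ℓ - 1] K - Kstar‖ ≤
      beta A B (riccatiGain A B R Kstar) ℓ * ‖K - Kstar‖ := by
  have hmem := iterate_bellman_mem_regionOfDecreasing hQ hR hK (ℓ - 1)
  have hpsd := Matrix.le_iff.1 (hs.le hQ hR hAQ hmem)
  rw [beta, min_mul_of_nonneg _ _ (norm_nonneg _), one_mul]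
  refine le_min ?_ (norm_le_norm_of_posSemidef hpsd (sub_le_sub_right
    (antitone_iterate_bellman hQ hR hK (Nat.zero_le (ℓ - 1))) _))
  exact (norm_le_norm_of_posSemidef hpsd (iterate_bellman_sub_le hQ hR hs hK (ℓ - 1))).trans
    (norm_transpose_mul_mul_le _ _)

theorem norm_sub_le_newtonGamma_mul_beta (hQ : Q.PosSemidef) (hR : R.PosDef)
    (hAQ : Detectable A (CFC.sqrt Q)) {Kstar K : Matrix (Fin n) (Fin n) ℝ}
    (hs : IsRiccatiSolution A B Q R Kstar) (hK : K ∈ regionOfDecreasing A B Q R) {ℓ : ℕ}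
    {L : Matrix (Fin m) (Fin n) ℝ} {KL : Matrix (Fin n) (Fin n) ℝ}
    (h : ‖KL - Kstar‖ ≤ newtonGamma A B R Kstar ((bellman A B Q R)^[ℓ - 1] K) L *
      ‖(bellman A B Q R)^[ℓ - 1] K - Kstar‖ ^ 2) :
    ‖KL - Kstar‖ ≤ newtonGamma A B R Kstar ((bellman A B Q R)^[ℓ - 1] K) L *
      beta A B (riccatiGain A B R Kstar) ℓ ^ 2 * ‖K - Kstar‖ ^ 2 := by
  rw [mul_assoc, ← mul_pow]
  refine h.trans (mul_le_mul_of_nonneg_left ?_ (newtonGamma_nonneg _ _ _))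
  exact pow_le_pow_left₀ (norm_nonneg _) (norm_iterate_bellman_sub_le hQ hR hAQ hs hK ℓ) 2

end NewtonStep

end LQR

/-! ### Assembly of the statement -/

theorem mainTheorem4 {n m : ℕ}
    (A : Matrix (Fin n) (Fin n) ℝ) (B : Matrix (Fin n) (Fin m) ℝ)
    (Q : Matrix (Fin n) (Fin n) ℝ) (R : Matrix (Fin m) (Fin m) ℝ)
    (hQ : Q.PosSemidef) (hR : R.PosDef)
    (hAB : LQR.Stabilizable A B) (hAQ : LQR.Detectable A (CFC.sqrt Q)) :
    -- `K*` is well defined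
    (∃! Kstar, LQR.IsRiccatiSolution A B Q R Kstar) ∧
    -- stable matrices have summable squared norms of powers
    (∀ D : Matrix (Fin n) (Fin n) ℝ, LQR.IsStabilityMatrix D →
      Summable fun i : ℕ => ‖D ^ i‖ ^ 2) ∧
    -- `K_L` is well defined for each stabilizing gain, and it is positive semidefinite
    (∀ L : Matrix (Fin m) (Fin n) ℝ, LQR.IsStabilityMatrix (A + B * L) →
      (∃! KL, KL = LQR.gainBellman A B Q R L KL) ∧
      ∀ KL, KL = LQR.gainBellman A B Q R L KL → KL.PosSemidef) ∧
    -- the MPC gain is well defined and stabilizing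
    (∀ K ∈ LQR.regionOfDecreasing A B Q R, ∀ ℓ : ℕ, 1 ≤ ℓ →
      (∃! L, LQR.gainBellman A B Q R L ((LQR.bellman A B Q R)^[ℓ - 1] K) =
        (LQR.bellman A B Q R)^[ℓ] K) ∧
      ∀ L, LQR.gainBellman A B Q R L ((LQR.bellman A B Q R)^[ℓ - 1] K) =
        (LQR.bellman A B Q R)^[ℓ] K → LQR.IsStabilityMatrix (A + B * L)) ∧
    ∀ Kstar Lstar, LQR.IsRiccatiSolution A B Q R Kstar → Lstar = LQR.riccatiGain A B R Kstar →
      -- the identity for the optimality gap of a stabilizing gain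
      (∀ (L : Matrix (Fin m) (Fin n) ℝ) (KL : Matrix (Fin n) (Fin n) ℝ),
        LQR.IsStabilityMatrix (A + B * L) → KL = LQR.gainBellman A B Q R L KL →
        KL - Kstar = (A + B * L)ᵀ * (KL - Kstar) * (A + B * L) +
          (L - Lstar)ᵀ * (Bᵀ * Kstar * B + R) * (L - Lstar)) ∧
      -- the quadratic estimate for one Newton step, with its explicit constant
      (∀ Kbar ∈ LQR.regionOfDecreasing A B Q R,
        ∀ (L : Matrix (Fin m) (Fin n) ℝ) (KL : Matrix (Fin n) (Fin n) ℝ),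
        LQR.gainBellman A B Q R L Kbar = LQR.bellman A B Q R Kbar →
        KL = LQR.gainBellman A B Q R L KL →
        ‖KL - Kstar‖ ≤ LQR.newtonGamma A B R Kstar Kbar L * ‖Kbar - Kstar‖ ^ 2 ∧
        ∃ γ : ℝ, 0 < γ ∧ ‖KL - Kstar‖ ≤ γ * ‖Kbar - Kstar‖ ^ 2) ∧
      -- the bounds for the MPC gain
      (∀ K ∈ LQR.regionOfDecreasing A B Q R, ∀ ℓ : ℕ, 1 ≤ ℓ →
        ∀ (L : Matrix (Fin m) (Fin n) ℝ) (KL : Matrix (Fin n) (Fin n) ℝ),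
        LQR.gainBellman A B Q R L ((LQR.bellman A B Q R)^[ℓ - 1] K) =
          (LQR.bellman A B Q R)^[ℓ] K →
        KL = LQR.gainBellman A B Q R L KL →
        ‖KL - Kstar‖ ≤ LQR.newtonGamma A B R Kstar ((LQR.bellman A B Q R)^[ℓ - 1] K) L *
          LQR.beta A B Lstar ℓ ^ 2 * ‖K - Kstar‖ ^ 2 ∧
        ∃ γ : ℝ, 0 < γ ∧
          ‖KL - Kstar‖ ≤ γ * ‖(LQR.bellman A B Q R)^[ℓ - 1] K - Kstar‖ ^ 2 ∧
          ‖KL - Kstar‖ ≤ γ * LQR.beta A B Lstar ℓ ^ 2 * ‖K - Kstar‖ ^ 2) := by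
  have iterate_eq (K : Matrix (Fin n) (Fin n) ℝ) {ℓ : ℕ} (hℓ : 1 ≤ ℓ) :
      (LQR.bellman A B Q R)^[ℓ] K = LQR.bellman A B Q R ((LQR.bellman A B Q R)^[ℓ - 1] K) := by
    obtain ⟨k, rfl⟩ := Nat.exists_eq_add_of_le' hℓ
    rw [Function.iterate_succ_apply', Nat.add_sub_cancel]
  refine ⟨LQR.existsUnique_isRiccatiSolution hQ hR hAB hAQ, fun D hD => hD.summable,
    fun L hL => ⟨LQR.existsUnique_gainBellman_fixedPoint hL,
      fun KL hKL => LQR.posSemidef_of_eq_gainBellman hQ hR hL hKL⟩,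
    fun K hK ℓ hℓ => ?_, ?_⟩
  · have hmem := LQR.iterate_bellman_mem_regionOfDecreasing hQ hR hK (ℓ - 1)
    simp only [iterate_eq K hℓ, LQR.gainBellman_eq_bellman_iff hR hmem.1]
    exact ⟨existsUnique_eq, fun L hL => hL ▸ LQR.isStabilityMatrix_riccatiGain hQ hR hAQ hmem⟩
  · rintro Kstar _ hs rfl
    refine ⟨fun L KL _ hKL => LQR.sub_eq_of_eq_gainBellman hR hs hKL,
      fun Kbar hKbar L KL hL hKL => ?_, fun K hK ℓ hℓ L KL hL hKL => ?_⟩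
    · have h := LQR.norm_sub_le_newtonGamma hQ hR hAQ hs hKbar hL hKL
      have h0 := LQR.newtonGamma_nonneg (A := A) (B := B) (R := R) Kstar Kbar L
      -- The witness is `γ₀ + 1`, since `γ₀` itself can be zero, for instance when `B = 0`.
      exact ⟨h, _, add_pos_of_nonneg_of_pos h0 one_pos, h.trans (by gcongr; linarith)⟩
    · have hmem := LQR.iterate_bellman_mem_regionOfDecreasing hQ hR hK (ℓ - 1)
      rw [iterate_eq K hℓ] at hL
      have h := LQR.norm_sub_le_newtonGamma hQ hR hAQ hs hmem hL hKL
      have h' := LQR.norm_sub_le_newtonGamma_mul_beta hQ hR hAQ hs hK h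
      have h0 := LQR.newtonGamma_nonneg (A := A) (B := B) (R := R) Kstar
        ((LQR.bellman A B Q R)^[ℓ - 1] K) L
      exact ⟨h', _, add_pos_of_nonneg_of_pos h0 one_pos, h.trans (by gcongr; linarith),
        h'.trans (by gcongr; linarith)⟩
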